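/- Let $\mathcal X$ be a Polish space with its Borel $\sigma$-algebra, and let $p(x,dy)$, $\widetilde p(x,dy)$ be probability kernels on $\mathcal X$ with invariant probability measures $\mu^*$, $\widetilde\mu^*$ respectively. Let $R(\cdot\|\cdot)\in[0,\infty]$ denote relative entropy, and assume $R(\widetilde\mu^*\|\mu^*)<\infty$. Let $\mathcal P[g](x)=\int g(y)\,p(x,dy)$, a bounded linear operator on the complex Hilbert space $L^2(\mu^*)$, and suppose that $\mathcal P-I$ satisfies the Poincaré inequality with constant $\alpha>0$: $$\operatorname{Re}\langle(\mathcal P-I)g,g\rangle\le-\alpha^{-1}\|P^\perp g\|_{L^2(\mu^*)}^2\quad\text{for all } g\in L^2(\mu^*),$$ where $P^\perp$ is the orthogonal projection onto the orthogonal complement of the constant functions. Then for every bounded measurable $f:\mathcal X\to\mathbb R$, $$\pm\big(\widetilde\mu^*[f]-\mu^*[f]\big)\le\sqrt{2\sigma^2\eta}+M^\pm\eta$$ (both signs), where $\mu[f]=\int f\,d\mu$, $$\sigma^2=2\alpha\operatorname{Var}_{\mu^*}[f],\qquad M^\pm=\alpha\,\big\|(f-\mu^*[f])^\pm\big\|_{L^\infty(\mu^*)},\qquad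 \eta=\int R\big(\widetilde p(x,\cdot)\,\|\,p(x,\cdot)\big)\,\widetilde\mu^*(dx)\in[0,\infty].$$ Here $g^+=\max(g,0)$, $g^-=\max(-g,0)$, and $0\cdot\infty=0$. -/

import Mathlib

open MeasureTheory ProbabilityTheory InformationTheory
open scoped ENNReal

namespace DiscreteUQ

variable {X : Type*} [MeasurableSpace X]

section Operator

variable {p : Kernel X X} [IsMarkovKernel p] {μ : Measure X} [IsProbabilityMeasure μ]

/-- Jensen's inequality for the averaging operator on `L²`. -/
lemma eLpNorm_kernel_average_le (hμ : p.Invariant μ) {g : X → ℂ} (hg : StronglyMeasurable g) :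
    eLpNorm (fun x => ∫ y, g y ∂(p x)) 2 μ ≤ eLpNorm g 2 μ := by
  have two : ∀ (ν : Measure X) (u : X → ℂ),
      eLpNorm u 2 ν = (∫⁻ x, ‖u x‖ₑ ^ (2 : ℝ) ∂ν) ^ (1 / (2 : ℝ)) := by
    intro ν u
    rw [eLpNorm_eq_lintegral_rpow_enorm_toReal (by norm_num) (by norm_num)]
    simp
  have jensen : ∀ x, ‖∫ y, g y ∂(p x)‖ₑ ^ (2 : ℝ) ≤ ∫⁻ y, ‖g y‖ₑ ^ (2 : ℝ) ∂(p x) := by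
    intro x
    have h1 : ‖∫ y, g y ∂(p x)‖ₑ ≤ eLpNorm g 2 (p x) :=
      (enorm_integral_le_lintegral_enorm _).trans
        (by
          rw [← eLpNorm_one_eq_lintegral_enorm]
          exact eLpNorm_le_eLpNorm_of_exponent_le (by norm_num) hg.aestronglyMeasurable)
    calc _ ≤ (eLpNorm g 2 (p x)) ^ (2 : ℝ) := ENNReal.rpow_le_rpow h1 (by norm_num)
      _ = _ := by rw [two, ← ENNReal.rpow_mul]; norm_num
  rw [two, two]
  refine ENNReal.rpow_le_rpow ?_ (by norm_num)
  calc _ ≤ ∫⁻ x, ∫⁻ y, ‖g y‖ₑ ^ (2 : ℝ) ∂(p x) ∂μ := lintegral_mono jensen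
    _ = ∫⁻ y, ‖g y‖ₑ ^ (2 : ℝ) ∂(μ.bind p) :=
        (Measure.lintegral_bind p.aemeasurable (hg.enorm.pow_const _).aemeasurable).symm
    _ = _ := by rw [hμ.def]

lemma memLp_kernel_average (hμ : p.Invariant μ) (g : Lp ℂ 2 μ) :
    MemLp (fun x => ∫ y, g y ∂(p x)) 2 μ :=
  ⟨(Lp.stronglyMeasurable g).integral_kernel.aestronglyMeasurable,
    (eLpNorm_kernel_average_le hμ (Lp.stronglyMeasurable g)).trans_lt (Lp.memLp g).2⟩

lemma ae_ae_of_invariant (hμ : p.Invariant μ) {q : X → Prop} (h : ∀ᵐ y ∂μ, q y) :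
    ∀ᵐ x ∂μ, ∀ᵐ y ∂(p x), q y :=
  Measure.ae_ae_of_ae_bind p.aemeasurable (by rwa [hμ.def])

lemma ae_integrable_of_invariant (hμ : p.Invariant μ) (g : Lp ℂ 2 μ) :
    ∀ᵐ x ∂μ, Integrable g (p x) := by
  have hint : Integrable g μ := (Lp.memLp g).integrable (by norm_num)
  have h : ∫⁻ x, ∫⁻ y, ‖g y‖ₑ ∂(p x) ∂μ < ∞ := by
    rw [← Measure.lintegral_bind p.aemeasurable
      (Lp.stronglyMeasurable g).enorm.aemeasurable, hμ.def]
    exact hint.2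
  filter_upwards [ae_lt_top (Lp.stronglyMeasurable g).enorm.lintegral_kernel h.ne] with x hx
  exact ⟨(Lp.stronglyMeasurable g).aestronglyMeasurable, hx⟩

/-- The operator `(𝒫 g)(x) = ∫ g(y) p(x,dy)` on the complex Hilbert space `L²(μ)`, for a
probability measure `μ` that is invariant for the probability kernel `p`. -/
noncomputable def transitionOp (p : Kernel X X) [IsMarkovKernel p] (μ : Measure X)
    [IsProbabilityMeasure μ] (hμ : p.Invariant μ) : Lp ℂ 2 μ →L[ℂ] Lp ℂ 2 μ :=
  LinearMap.mkContinuous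
    { toFun := fun g => (memLp_kernel_average hμ g).toLp
      map_add' := by
        intro g h
        rw [← MemLp.toLp_add]
        refine MemLp.toLp_congr _ _ ?_
        filter_upwards [ae_ae_of_invariant hμ (Lp.coeFn_add g h),
          ae_integrable_of_invariant hμ g, ae_integrable_of_invariant hμ h] with x hx hg hh
        rw [integral_congr_ae hx]
        exact integral_add hg hh
      map_smul' := by
        intro c g
        rw [RingHom.id_apply, ← MemLp.toLp_const_smul]
        refine MemLp.toLp_congr _ _ ?_
        filter_upwards [ae_ae_of_invariant hμ (Lp.coeFn_smul c g)] with x hx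
        rw [integral_congr_ae hx]
        exact integral_smul c _ }
    1
    (by
      intro g
      rw [one_mul]
      change ‖(memLp_kernel_average hμ g).toLp‖ ≤ ‖g‖
      rw [Lp.norm_toLp, Lp.norm_def]
      exact ENNReal.toReal_mono (Lp.memLp g).2.ne
        (eLpNorm_kernel_average_le hμ (Lp.stronglyMeasurable g)))

lemma transitionOp_coeFn (hμ : p.Invariant μ) (g : Lp ℂ 2 μ) :
    transitionOp p μ hμ g =ᵐ[μ] fun x => ∫ y, g y ∂(p x) :=
  (memLp_kernel_average hμ g).coeFn_toLp

end Operator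

/-- The Poincaré inequality with constant `α` for the generator `𝒫 - I`:
`Re ⟨(𝒫 - I) g, g⟩ ≤ -α⁻¹ ‖P^⊥ g‖²` for all `g ∈ L²(μ)`, where `P^⊥` is the orthogonal projection
onto the orthogonal complement of the constant functions. -/
def PoincareInequality (p : Kernel X X) [IsMarkovKernel p] (μ : Measure X)
    [IsProbabilityMeasure μ] (hμ : p.Invariant μ) (α : ℝ) : Prop :=
  ∀ g : Lp ℂ 2 μ,
    (inner ℂ ((transitionOp p μ hμ - ContinuousLinearMap.id ℂ (Lp ℂ 2 μ)) g) g).re ≤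
      -α⁻¹ * ‖(ℂ ∙ (Lp.const 2 μ (1 : ℂ)))ᗮ.starProjection g‖ ^ 2

/-- `η = ∫ R(p̃(x,·) ‖ p(x,·)) μ̃(dx)`, where `R` is relative entropy; possibly `∞`. -/
noncomputable def entropyRate (p' p : Kernel X X) (μ' : Measure X) : ℝ≥0∞ :=
  ∫⁻ x, klDiv (p' x) (p x) ∂μ'

/-- The Bernstein-type bound `√(2 σ² η) + M η`; it is `∞` when `η = ∞`, unless `σ² = M = 0`. -/
noncomputable def bernsteinBound (sigmaSq M η : ℝ≥0∞) : ℝ≥0∞ :=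
  (2 * sigmaSq * η) ^ (1 / 2 : ℝ) + M * η

end DiscreteUQ

namespace DiscreteUQ

open Filter Topology

/-! Finite relative entropy gives `μ' ≪ μ`, so write `dμ' = g² dμ` with `g ≥ 0`; thus `g` is a unit
vector of `L²(μ)`. The entropy rate controls the Dirichlet form of `g`: for bounded `u` bounded away
from zero, testing each `R(p'(x,·) ‖ p(x,·))` with `y ↦ log (u y / u x)` and averaging over `μ'`
cancels the logarithms by invariance of `μ'` and leaves `η ≥ 1 - ∫ (𝒫u / u) dμ'`. Letting `u`
approach `g` yields `η ≥ 1 - ⟨𝒫g, g⟩` (`ofReal_one_sub_integral_mul_le_entropyRate`), and the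
Poincaré inequality turns this into `Var_μ[g] ≤ α η`.

With `F = f - μ[f]` and `m = μ[g] ∈ [0,1]`, expanding `g = m + (g - m)` gives `∫ g² F = 2m ∫ F (g -
m) + ∫ F (g - m)²`, because `F` is centred. Cauchy–Schwarz bounds the first term by `2 √(Var f · α
η)`, and the essential supremum of `F⁺` bounds the second (`integral_mul_sq_le`). The other sign
follows by replacing `f` with `-f`. -/

lemma mul_add_one_sub_exp_le_klFun {r : ℝ} (hr : 0 ≤ r) (t : ℝ) :
    r * t + 1 - Real.exp t ≤ klFun r := by
  rw [klFun]
  rcases hr.eq_or_lt with rfl | hr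
  · have := Real.exp_pos t
    simp; linarith
  -- The bound `log z ≤ z - 1` at `z = exp t / r`, multiplied by `r`.
  · have h := Real.log_le_sub_one_of_pos (div_pos (Real.exp_pos t) hr)
    rw [Real.log_div (Real.exp_pos t).ne' hr.ne', Real.log_exp] at h
    have h' := mul_le_mul_of_nonneg_left h hr.le
    rw [mul_sub, mul_sub, mul_div_cancel₀ _ hr.ne'] at h'
    linarith

/-- Allows signed lower bounds to be integrated against `[0,∞]`-valued entropies without knowing
that these are finite. -/
lemma ofReal_integral_le_lintegral {X : Type*} [MeasurableSpace X] {μ : Measure X} {F : X → ℝ}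
    (hF : Integrable F μ) : ENNReal.ofReal (∫ x, F x ∂μ) ≤ ∫⁻ x, ENNReal.ofReal (F x) ∂μ := by
  have hpos : Integrable (fun x => max (F x) 0) μ := hF.pos_part
  calc ENNReal.ofReal (∫ x, F x ∂μ) ≤ ENNReal.ofReal (∫ x, max (F x) 0 ∂μ) :=
        ENNReal.ofReal_le_ofReal (integral_mono hF hpos fun x => le_max_left _ _)
    _ = ∫⁻ x, ENNReal.ofReal (max (F x) 0) ∂μ :=
        ofReal_integral_eq_lintegral_ofReal hpos (ae_of_all _ fun x => le_max_right _ _)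
    _ = _ := by simp

/-! ### Variational lower bounds for relative entropy and for the entropy rate -/

section Variational

variable {X : Type*} [MeasurableSpace X]

/-- A weak form of the Donsker–Varadhan variational inequality for relative entropy. -/
lemma ofReal_integral_add_one_sub_le_klDiv (ν' ν : Measure X) [IsProbabilityMeasure ν']
    [IsProbabilityMeasure ν] {φ : X → ℝ} (hφ : Measurable φ) {C : ℝ} (hC : ∀ x, |φ x| ≤ C) :
    ENNReal.ofReal (∫ x, φ x ∂ν' + 1 - ∫ x, Real.exp (φ x) ∂ν) ≤ klDiv ν' ν := by
  by_cases hac : ν' ≪ ν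
  · rw [klDiv_eq_lintegral_klFun_of_ac hac]
    have hexp : Integrable (fun x => Real.exp (φ x)) ν :=
      Integrable.of_bound hφ.exp.aestronglyMeasurable (Real.exp C) (ae_of_all _ fun x => by
        rw [Real.norm_eq_abs, Real.abs_exp]
        exact Real.exp_le_exp.2 (abs_le.1 (hC x)).2)
    have hmul : Integrable (fun x => (ν'.rnDeriv ν x).toReal * φ x) ν :=
      Measure.integrable_toReal_rnDeriv.mul_bdd hφ.aestronglyMeasurable (ae_of_all _ hC)
    have heq : ∫ x, φ x ∂ν' + 1 - ∫ x, Real.exp (φ x) ∂ν =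
        ∫ x, ((ν'.rnDeriv ν x).toReal * φ x + 1 - Real.exp (φ x)) ∂ν := by
      rw [integral_sub (f := fun x => (ν'.rnDeriv ν x).toReal * φ x + 1)
          (hmul.add (integrable_const _)) hexp,
        integral_add hmul (integrable_const _), integral_toReal_rnDeriv_mul hac]
      simp
    rw [heq]
    exact (ofReal_integral_le_lintegral ((hmul.add (integrable_const _)).sub hexp)).trans
      (lintegral_mono fun x => ENNReal.ofReal_le_ofReal
        (mul_add_one_sub_exp_le_klFun ENNReal.toReal_nonneg _))
  · rw [klDiv_of_not_ac hac]
    exact le_top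

/-- Both sides integrate `φ(y)` against the joint law `μ ⊗ₘ p`, whose second marginal is `μ` by
invariance. -/
lemma integral_kernel_of_invariant {p : Kernel X X} [IsMarkovKernel p] {μ : Measure X}
    [IsProbabilityMeasure μ] (hμ : p.Invariant μ) {φ : X → ℝ} (hφ : Integrable φ μ) :
    ∫ x, ∫ y, φ y ∂(p x) ∂μ = ∫ x, φ x ∂μ := by
  have hsnd : (μ ⊗ₘ p).map Prod.snd = μ := by
    rw [← Measure.snd, Measure.snd_compProd, hμ.def]
  have hφ' : Integrable φ ((μ ⊗ₘ p).map Prod.snd) := by rwa [hsnd]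
  have h : Integrable (fun z : X × X => φ z.2) (μ ⊗ₘ p) := hφ'.comp_measurable measurable_snd
  rw [← Measure.integral_compProd (f := fun z : X × X => φ z.2) h,
    ← integral_map measurable_snd.aemeasurable hφ'.aestronglyMeasurable, hsnd]

/-- The Donsker–Varadhan lower bound for the entropy production of a stationary chain. -/
lemma ofReal_one_sub_integral_div_le_entropyRate {p p' : Kernel X X} [IsMarkovKernel p]
    [IsMarkovKernel p'] {μ' : Measure X} [IsProbabilityMeasure μ'] (hμ' : p'.Invariant μ')
    {u : X → ℝ} (hu : Measurable u) {a b : ℝ} (ha : 0 < a) (hau : ∀ x, a ≤ u x)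
    (hub : ∀ x, u x ≤ b) :
    ENNReal.ofReal (1 - ∫ x, (∫ y, u y ∂(p x)) / u x ∂μ') ≤ entropyRate p' p μ' := by
  have hpos : ∀ x, 0 < u x := fun x => ha.trans_le (hau x)
  have hlog : ∀ x, |Real.log (u x)| ≤ max |Real.log a| |Real.log b| := fun x =>
    abs_le_max_abs_abs (Real.log_le_log ha (hau x)) (Real.log_le_log (hpos x) (hub x))
  have hlogint : Integrable (fun x => Real.log (u x)) μ' :=
    Integrable.of_bound hu.log.aestronglyMeasurable _ (ae_of_all _ hlog)
  have hPlogint : Integrable (fun x => ∫ y, Real.log (u y) ∂(p' x)) μ' :=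
    Integrable.of_bound hu.log.stronglyMeasurable.integral_kernel.aestronglyMeasurable
      (max |Real.log a| |Real.log b|)
      (ae_of_all _ fun x => by
        simpa using norm_integral_le_of_norm_le_const (μ := p' x)
          (f := fun y => Real.log (u y)) (ae_of_all _ hlog))
  have hPu : ∀ x, |∫ y, u y ∂(p x)| ≤ b := fun x => by
    simpa using norm_integral_le_of_norm_le_const (μ := p x) (f := u) (C := b)
      (ae_of_all _ fun y => by rw [Real.norm_eq_abs, abs_of_pos (hpos y)]; exact hub y)
  have hdivint : Integrable (fun x => (∫ y, u y ∂(p x)) / u x) μ' :=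
    Integrable.of_bound
      (hu.stronglyMeasurable.integral_kernel.measurable.div hu).aestronglyMeasurable (b / a)
      (ae_of_all _ fun x => by
        rw [norm_div, Real.norm_eq_abs, Real.norm_eq_abs, abs_of_pos (hpos x)]
        exact div_le_div₀ ((abs_nonneg _).trans (hPu x)) (hPu x) ha (hau x))
  have heq : 1 - ∫ x, (∫ y, u y ∂(p x)) / u x ∂μ' =
      ∫ x, ((∫ y, Real.log (u y) ∂(p' x)) - Real.log (u x) + 1 - (∫ y, u y ∂(p x)) / u x) ∂μ' := by
    rw [integral_sub (f := fun x => (∫ y, Real.log (u y) ∂(p' x)) - Real.log (u x) + 1)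
        ((hPlogint.sub hlogint).add (integrable_const _)) hdivint,
      integral_add (f := fun x => (∫ y, Real.log (u y) ∂(p' x)) - Real.log (u x))
        (hPlogint.sub hlogint) (integrable_const _), integral_sub hPlogint hlogint,
      integral_kernel_of_invariant hμ' hlogint]
    simp
  rw [heq]
  refine (ofReal_integral_le_lintegral
    (((hPlogint.sub hlogint).add (integrable_const _)).sub hdivint)).trans
    (lintegral_mono fun x => ?_)
  -- With `x` fixed, the exponential of this test function integrates to `𝒫u(x) / u(x)`.
  have key := ofReal_integral_add_one_sub_le_klDiv (p' x) (p x)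
    (φ := fun y => Real.log (u y) - Real.log (u x)) (hu.log.sub_const _)
    (C := max |Real.log a| |Real.log b| + max |Real.log a| |Real.log b|)
    fun y => (abs_sub _ _).trans (add_le_add (hlog y) (hlog x))
  refine le_of_eq_of_le ?_ key
  rw [integral_sub (Integrable.of_bound hu.log.aestronglyMeasurable _ (ae_of_all _ hlog))
    (integrable_const _)]
  simp_rw [Real.exp_sub, Real.exp_log (hpos _), integral_div]
  simp

/-- For a stationary law with square-root density `g`, the entropy production dominates the
Dirichlet form of `g`. -/
lemma ofReal_one_sub_integral_mul_le_entropyRate {p p' : Kernel X X} [IsMarkovKernel p]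
    [IsMarkovKernel p'] {μ μ' : Measure X} [IsProbabilityMeasure μ] [IsProbabilityMeasure μ']
    (hμ' : p'.Invariant μ') {g : X → ℝ} (hg : Measurable g)
    (hg0 : ∀ x, 0 ≤ g x) (hg2 : MemLp g 2 μ)
    (hgp : ∀ᵐ x ∂μ, Integrable g (p x))
    (hPg : Integrable (fun x => (∫ y, g y ∂(p x)) * g x) μ)
    (hdens : ∀ φ : X → ℝ, ∫ x, φ x ∂μ' = ∫ x, g x ^ 2 * φ x ∂μ) :
    ENNReal.ofReal (1 - ∫ x, (∫ y, g y ∂(p x)) * g x ∂μ) ≤ entropyRate p' p μ' := by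
  have hg1 : Integrable g μ := hg2.integrable (by norm_num)
  have hgsq : Integrable (fun x => g x ^ 2) μ := hg2.integrable_sq
  have hone : ∫ x, g x ^ 2 ∂μ = 1 := by simpa using (hdens fun _ => 1).symm
  let A : ℕ → Set X := fun n => {x | g x ≤ (n : ℝ) + 1}
  have hA : ∀ n, MeasurableSet (A n) := fun n => measurableSet_le hg measurable_const
  have hlim : Tendsto (fun n => ∫ x, (A n).indicator (fun x => g x ^ 2) x ∂μ) atTop (𝓝 1) := by
    rw [← hone]
    refine tendsto_integral_of_dominated_convergence (fun x => g x ^ 2)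
      (fun n => ((hg.pow_const 2).indicator (hA n)).aestronglyMeasurable) hgsq
      (fun n => ae_of_all _ fun x => ?_) (ae_of_all _ fun x => ?_)
    · rw [Real.norm_eq_abs, abs_of_nonneg (Set.indicator_nonneg (fun y _ => sq_nonneg _) _)]
      exact Set.indicator_le_self' (fun y _ => sq_nonneg _) x
    · refine tendsto_const_nhds.congr' ?_
      obtain ⟨N, hN⟩ := exists_nat_ge (g x)
      filter_upwards [eventually_ge_atTop N] with n hn
      have : x ∈ A n := by
        have : (N : ℝ) ≤ n := by exact_mod_cast hn
        change g x ≤ (n : ℝ) + 1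
        linarith
      rw [Set.indicator_of_mem this]
  have hlim2 : Tendsto (fun n : ℕ => ENNReal.ofReal
      ((∫ x, (A n).indicator (fun x => g x ^ 2) x ∂μ) - (∫ x, (∫ y, g y ∂(p x)) * g x ∂μ)
        - 1 / ((n : ℝ) + 1) * ∫ x, g x ∂μ)) atTop
      (𝓝 (ENNReal.ofReal (1 - ∫ x, (∫ y, g y ∂(p x)) * g x ∂μ))) := by
    refine ENNReal.tendsto_ofReal ?_
    simpa using (hlim.sub_const _).sub
      ((tendsto_one_div_add_atTop_nhds_zero_nat (𝕜 := ℝ)).mul_const (∫ x, g x ∂μ))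
  refine le_of_tendsto' hlim2 fun n => ?_
  set b : ℝ := (n : ℝ) + 1 with hb
  have hb1 : 1 ≤ b := by simp [hb]
  have hb0 : 0 < b := by linarith
  have hab : 1 / b ≤ b := (div_le_one hb0).2 hb1 |>.trans hb1
  -- Clipping `g` to `[1/b, b]` makes it admissible. The estimate `u ≤ g + 1/b` costs the error term
  -- `(1/b) ∫ g`, which vanishes in the limit.
  let u : X → ℝ := fun x => min b (max (1 / b) (g x))
  have hum : Measurable u := measurable_const.min (measurable_const.max hg)
  have hau : ∀ x, 1 / b ≤ u x := fun x => le_min hab (le_max_left _ _)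
  have hub : ∀ x, u x ≤ b := fun x => min_le_left _ _
  have hupos : ∀ x, 0 < u x := fun x => (one_div_pos.2 hb0).trans_le (hau x)
  have huint : ∀ ν : Measure X, [IsProbabilityMeasure ν] → Integrable u ν := fun ν _ =>
    Integrable.of_bound hum.aestronglyMeasurable b
      (ae_of_all _ fun x => by rw [Real.norm_eq_abs, abs_of_pos (hupos x)]; exact hub x)
  have hug : ∀ x, u x ≤ g x + 1 / b := fun x => (min_le_right _ _).trans
    (max_le (le_add_of_nonneg_left (hg0 x)) (le_add_of_nonneg_right (one_div_pos.2 hb0).le))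
  have hPub : ∀ x, ∫ y, u y ∂(p x) ≤ b := fun x => by
    simpa using integral_mono (huint (p x)) (integrable_const b) hub
  have hPu0 : ∀ x, 0 ≤ ∫ y, u y ∂(p x) := fun x => integral_nonneg fun y => (hupos y).le
  refine le_trans (ENNReal.ofReal_le_ofReal ?_)
    (ofReal_one_sub_integral_div_le_entropyRate (p := p) hμ' hum (one_div_pos.2 hb0) hau hub)
  have hind : Integrable ((A n).indicator fun x => g x ^ 2) μ := hgsq.indicator (hA n)
  have hdiv : Integrable (fun x => (∫ y, u y ∂(p x)) / u x) μ' :=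
    Integrable.of_bound
      (hum.stronglyMeasurable.integral_kernel.measurable.div hum).aestronglyMeasurable
      (b / (1 / b)) (ae_of_all _ fun x => by
        rw [Real.norm_eq_abs, abs_of_nonneg (div_nonneg (hPu0 x) (hupos x).le)]
        exact div_le_div₀ hb0.le (hPub x) (one_div_pos.2 hb0) (hau x))
  have hbd : Integrable (fun x => g x ^ 2 * (1 - (∫ y, u y ∂(p x)) / u x)) μ :=
    hgsq.mul_bdd (c := 1 + b / (1 / b))
      ((measurable_const.sub
        (hum.stronglyMeasurable.integral_kernel.measurable.div hum)).aestronglyMeasurable)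
      (ae_of_all _ fun x => (norm_sub_le _ _).trans (add_le_add (by simp) (by
        rw [Real.norm_eq_abs, abs_of_nonneg (div_nonneg (hPu0 x) (hupos x).le)]
        exact div_le_div₀ hb0.le (hPub x) (one_div_pos.2 hb0) (hau x))))
  have hright : 1 - ∫ x, (∫ y, u y ∂(p x)) / u x ∂μ' =
      ∫ x, g x ^ 2 * (1 - (∫ y, u y ∂(p x)) / u x) ∂μ := by
    rw [← hdens, integral_sub (integrable_const _) hdiv]
    simp
  rw [hright, ← integral_const_mul, ← integral_sub hind hPg,
    ← integral_sub (f := fun x => (A n).indicator (fun x => g x ^ 2) x - (∫ y, g y ∂(p x)) * g x)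
      (hind.sub hPg) (hg1.const_mul _)]
  refine integral_mono_ae ((hind.sub hPg).sub (hg1.const_mul _)) hbd ?_
  -- Pointwise comparison. Where `g ≤ b`, `g ≤ u` gives `g² 𝒫u / u ≤ g 𝒫u ≤ g (𝒫g + 1/b)`. Where `g
  -- > b`, `u = b` and `𝒫u ≤ b` make the right side nonnegative, while the left side is at most
  -- zero.
  filter_upwards [hgp] with x hx
  have hPg0 : 0 ≤ ∫ y, g y ∂(p x) := integral_nonneg hg0
  by_cases hxA : x ∈ A n
  · have hgu : g x ≤ u x := le_min hxA (le_max_right _ _)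
    have hPug : ∫ y, u y ∂(p x) ≤ (∫ y, g y ∂(p x)) + 1 / b := by
      have := integral_mono (huint (p x)) (hx.add (integrable_const (1 / b))) hug
      rw [integral_add' hx (integrable_const _)] at this
      simpa using this
    have hle : g x ^ 2 * ((∫ y, u y ∂(p x)) / u x) ≤ ((∫ y, g y ∂(p x)) + 1 / b) * g x := by
      rw [← mul_div_assoc, div_le_iff₀ (hupos x)]
      calc g x ^ 2 * ∫ y, u y ∂(p x) = (∫ y, u y ∂(p x)) * g x * g x := by ring
        _ ≤ ((∫ y, g y ∂(p x)) + 1 / b) * g x * u x := by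
          refine mul_le_mul (mul_le_mul_of_nonneg_right hPug (hg0 x)) hgu (hg0 x) ?_
          have := hg0 x
          positivity
    simp only [Set.indicator_of_mem hxA]
    nlinarith
  · have hxb : b < g x := not_le.1 hxA
    have hux : u x = b := min_eq_left (hxb.le.trans (le_max_right _ _))
    have hle : (∫ y, u y ∂(p x)) / u x ≤ 1 := by
      rw [hux]; exact (div_le_one hb0).2 (hPub x)
    simp only [Set.indicator_of_notMem hxA]
    have h1 : 0 ≤ (∫ y, g y ∂(p x)) * g x := mul_nonneg hPg0 (hg0 x)
    have h2 : 0 ≤ 1 / b * g x := mul_nonneg (one_div_pos.2 hb0).le (hg0 x)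
    have h3 : 0 ≤ g x ^ 2 * (1 - (∫ y, u y ∂(p x)) / u x) :=
      mul_nonneg (sq_nonneg _) (by linarith)
    linarith

end Variational

/-! ### Real functions inside complex `L²` -/

section RealFunctions

variable {X : Type*} [MeasurableSpace X] {μ : Measure X}

/-- A real square-integrable function as an element of the complex `L²` space. -/
noncomputable def realToLp {a : X → ℝ} (ha : MemLp a 2 μ) : Lp ℂ 2 μ :=
  (ha.ofReal (K := ℂ)).toLp

lemma realToLp_coeFn {a : X → ℝ} (ha : MemLp a 2 μ) :
    realToLp ha =ᵐ[μ] fun x => (a x : ℂ) :=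
  (ha.ofReal (K := ℂ)).coeFn_toLp

lemma inner_realToLp {a b : X → ℝ} (ha : MemLp a 2 μ) (hb : MemLp b 2 μ) :
    inner ℂ (realToLp ha) (realToLp hb) = ((∫ x, a x * b x ∂μ : ℝ) : ℂ) := by
  rw [L2.inner_def, ← integral_complex_ofReal]
  refine integral_congr_ae ?_
  filter_upwards [realToLp_coeFn ha, realToLp_coeFn hb] with x h1 h2
  rw [h1, h2]
  simp [mul_comm]

lemma realToLp_sub {a b : X → ℝ} (ha : MemLp a 2 μ) (hb : MemLp b 2 μ) :
    realToLp (ha.sub hb) = realToLp ha - realToLp hb := by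
  refine Lp.ext ?_
  filter_upwards [realToLp_coeFn (ha.sub hb), realToLp_coeFn ha, realToLp_coeFn hb,
    Lp.coeFn_sub (realToLp ha) (realToLp hb)] with x h1 h2 h3 h4
  rw [h1, h4, Pi.sub_apply, Pi.sub_apply, h2, h3]
  simp

lemma realToLp_const [IsProbabilityMeasure μ] (c : ℝ) :
    realToLp (memLp_const c : MemLp (fun _ : X => c) 2 μ) = (c : ℂ) • Lp.const 2 μ (1 : ℂ) := by
  refine Lp.ext ?_
  filter_upwards [realToLp_coeFn (memLp_const c : MemLp (fun _ : X => c) 2 μ),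
    Lp.coeFn_smul (c : ℂ) (Lp.const 2 μ (1 : ℂ)), Lp.coeFn_const (p := 2) (μ := μ) (1 : ℂ)]
    with x h1 h2 h3
  rw [h1, h2, Pi.smul_apply, h3]
  simp

lemma norm_sq_starProjection_realToLp [IsProbabilityMeasure μ] {g : X → ℝ} (hg : MemLp g 2 μ) :
    ‖(ℂ ∙ (Lp.const 2 μ (1 : ℂ)))ᗮ.starProjection (realToLp hg)‖ ^ 2 =
      ∫ x, (g x - ∫ y, g y ∂μ) ^ 2 ∂μ := by
  set m := ∫ y, g y ∂μ
  have hm : MemLp (fun _ : X => m) 2 μ := memLp_const m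
  have hone : Lp.const 2 μ (1 : ℂ) =
      realToLp (memLp_const (1 : ℝ) : MemLp (fun _ : X => (1 : ℝ)) 2 μ) := by
    rw [realToLp_const]; simp
  have hproj : (ℂ ∙ (Lp.const 2 μ (1 : ℂ)))ᗮ.starProjection (realToLp hg) =
      realToLp (hg.sub hm) := by
    -- The orthogonal decomposition is `g = (g - m) + m`.
    refine Submodule.eq_starProjection_of_mem_orthogonal' (z := realToLp hm) ?_ ?_ ?_
    · rw [Submodule.mem_orthogonal_singleton_iff_inner_right, hone, inner_realToLp]
      simp only [Pi.sub_apply, one_mul, Complex.ofReal_eq_zero]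
      rw [integral_sub (hg.integrable (by norm_num)) (integrable_const _)]
      simp [m]
    · rw [realToLp_const]
      exact Submodule.le_orthogonal_orthogonal _
        (Submodule.smul_mem _ _ (Submodule.mem_span_singleton_self _))
    · rw [realToLp_sub hg hm]; abel
  rw [hproj, ← inner_self_eq_norm_sq (𝕜 := ℂ), inner_realToLp]
  simp [pow_two]

end RealFunctions

/-! ### The Poincaré inequality on real functions -/

section Poincare

variable {X : Type*} [MeasurableSpace X] {p : Kernel X X} [IsMarkovKernel p] {μ : Measure X}
  [IsProbabilityMeasure μ]

lemma ae_integrable_kernel_of_memLp (hμ : p.Invariant μ) {g : X → ℝ} (hg : MemLp g 2 μ) :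
    ∀ᵐ x ∂μ, Integrable g (p x) := by
  filter_upwards [ae_integrable_of_invariant hμ (realToLp hg),
    ae_ae_of_invariant hμ (realToLp_coeFn hg)] with x h1 h2
  simpa using (h1.congr h2).re

lemma transitionOp_realToLp_coeFn (hμ : p.Invariant μ) {g : X → ℝ} (hg : MemLp g 2 μ) :
    transitionOp p μ hμ (realToLp hg) =ᵐ[μ] fun x => ((∫ y, g y ∂(p x) : ℝ) : ℂ) := by
  filter_upwards [transitionOp_coeFn hμ (realToLp hg),
    ae_ae_of_invariant hμ (realToLp_coeFn hg)] with x h1 h2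
  rw [h1, integral_congr_ae h2, integral_complex_ofReal]

lemma memLp_kernel_average_real (hμ : p.Invariant μ) {g : X → ℝ} (hg : MemLp g 2 μ) :
    MemLp (fun x => ∫ y, g y ∂(p x)) 2 μ := by
  have h := ((memLp_congr_ae (transitionOp_realToLp_coeFn hμ hg)).1
    (Lp.memLp (transitionOp p μ hμ (realToLp hg)))).re
  simpa using h

/-- The Poincaré inequality for real functions, in integral form. -/
lemma PoincareInequality.integral_le {hμ : p.Invariant μ} {α : ℝ}
    (hP : PoincareInequality p μ hμ α) {g : X → ℝ} (hg : MemLp g 2 μ) :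
    α⁻¹ * ∫ x, (g x - ∫ y, g y ∂μ) ^ 2 ∂μ ≤
      ∫ x, g x ^ 2 ∂μ - ∫ x, (∫ y, g y ∂(p x)) * g x ∂μ := by
  have hPg := memLp_kernel_average_real hμ hg
  have hT : transitionOp p μ hμ (realToLp hg) = realToLp hPg :=
    Lp.ext ((transitionOp_realToLp_coeFn hμ hg).trans (realToLp_coeFn hPg).symm)
  have h := hP (realToLp hg)
  rw [norm_sq_starProjection_realToLp, sub_apply, ContinuousLinearMap.id_apply,
    hT, inner_sub_left, inner_realToLp, inner_realToLp, ← Complex.ofReal_sub,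
    Complex.ofReal_re] at h
  simp_rw [pow_two] at h ⊢
  linarith

end Poincare

/-! ### From the variance of the square-root density to the Bernstein bound -/

section Bound

variable {X : Type*} [MeasurableSpace X] {μ : Measure X}

lemma integral_mul_le_sqrt_mul_sqrt {a b : X → ℝ} (ha : MemLp a 2 μ) (hb : MemLp b 2 μ) :
    ∫ x, a x * b x ∂μ ≤ √(∫ x, a x ^ 2 ∂μ) * √(∫ x, b x ^ 2 ∂μ) := by
  have h := real_inner_le_norm (ha.toLp a) (hb.toLp b)
  have hin : ∀ {a b : X → ℝ} (ha : MemLp a 2 μ) (hb : MemLp b 2 μ),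
      inner ℝ (ha.toLp a) (hb.toLp b) = ∫ x, a x * b x ∂μ := by
    intro a b ha hb
    rw [L2.inner_def]
    refine integral_congr_ae ?_
    filter_upwards [ha.coeFn_toLp, hb.coeFn_toLp] with x h1 h2
    rw [h1, h2]
    simp [mul_comm]
  rw [norm_eq_sqrt_real_inner, norm_eq_sqrt_real_inner, hin, hin, hin] at h
  simpa only [pow_two] using h

variable [IsProbabilityMeasure μ]

/-- Expansion of a centred observable in a square-root density around its mean. -/
lemma integral_mul_sq_le {g F : X → ℝ} (hg : MemLp g 2 μ) (hg0 : ∀ x, 0 ≤ g x)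
    (hg1 : ∫ x, g x ^ 2 ∂μ = 1) (hF : Measurable F) {C : ℝ} (hC : ∀ x, |F x| ≤ C)
    (hF0 : ∫ x, F x ∂μ = 0) {K : ℝ} (hK : ∀ᵐ x ∂μ, F x ≤ K) :
    ∫ x, g x ^ 2 * F x ∂μ ≤
      2 * (√(∫ x, F x ^ 2 ∂μ) * √(∫ x, (g x - ∫ y, g y ∂μ) ^ 2 ∂μ)) +
        K * ∫ x, (g x - ∫ y, g y ∂μ) ^ 2 ∂μ := by
  set m := ∫ y, g y ∂μ with hm
  have hgint : Integrable g μ := hg.integrable (by norm_num)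
  have hv : MemLp (fun x => g x - m) 2 μ := hg.sub (memLp_const m)
  have hF2 : MemLp F 2 μ := MemLp.of_bound hF.aestronglyMeasurable C (ae_of_all _ hC)
  have hFint : Integrable F μ := hF2.integrable (by norm_num)
  have hFv : Integrable (fun x => F x * (g x - m)) μ := hF2.integrable_mul hv
  have hv2 : Integrable (fun x => (g x - m) ^ 2) μ := hv.integrable_sq
  have hFv2 : Integrable (fun x => (g x - m) ^ 2 * F x) μ :=
    hv2.mul_bdd hF.aestronglyMeasurable (ae_of_all _ hC)
  have hm0 : 0 ≤ m := integral_nonneg hg0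
  -- Cauchy–Schwarz against the constant `1`.
  have hm1 : m ≤ 1 := by
    have h := integral_mul_le_sqrt_mul_sqrt hg (memLp_const (1 : ℝ))
    simpa [hg1] using h
  have hexp : ∫ x, g x ^ 2 * F x ∂μ =
      m ^ 2 * ∫ x, F x ∂μ + 2 * m * ∫ x, F x * (g x - m) ∂μ + ∫ x, (g x - m) ^ 2 * F x ∂μ := by
    rw [← integral_const_mul, ← integral_const_mul,
      ← integral_add (hFint.const_mul _) (hFv.const_mul _),
      ← integral_add (f := fun x => m ^ 2 * F x + 2 * m * (F x * (g x - m)))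
        ((hFint.const_mul _).add (hFv.const_mul _)) hFv2]
    exact integral_congr_ae (ae_of_all _ fun x => by ring)
  rw [hexp, hF0, mul_zero, zero_add]
  have h1 := integral_mul_le_sqrt_mul_sqrt hF2 hv
  have h2 : ∫ x, (g x - m) ^ 2 * F x ∂μ ≤ K * ∫ x, (g x - m) ^ 2 ∂μ := by
    rw [← integral_const_mul]
    refine integral_mono_ae hFv2 (hv2.const_mul _) ?_
    filter_upwards [hK] with x hx
    rw [mul_comm K]
    exact mul_le_mul_of_nonneg_left hx (sq_nonneg _)
  have h3 : m * ∫ x, F x * (g x - m) ∂μ ≤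
      √(∫ x, F x ^ 2 ∂μ) * √(∫ x, (g x - m) ^ 2 ∂μ) :=
    (mul_le_mul_of_nonneg_left h1 hm0).trans (mul_le_of_le_one_left (by positivity) hm1)
  linarith

lemma bernsteinBound_top {s M : ℝ≥0∞} (hs : s ≠ 0) : bernsteinBound s M ∞ = ∞ := by
  simp [bernsteinBound, hs]

lemma bernsteinBound_ofReal {s M η : ℝ} (hs : 0 ≤ s) (hM : 0 ≤ M) (hη : 0 ≤ η) :
    bernsteinBound (ENNReal.ofReal s) (ENNReal.ofReal M) (ENNReal.ofReal η) =
      ENNReal.ofReal (√(2 * s * η) + M * η) := by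
  rw [bernsteinBound, ENNReal.ofReal_add (Real.sqrt_nonneg _) (mul_nonneg hM hη),
    ENNReal.ofReal_mul hM, Real.sqrt_eq_rpow, ← ENNReal.ofReal_rpow_of_nonneg (by positivity)
    (by norm_num), ENNReal.ofReal_mul (by positivity), ENNReal.ofReal_mul (by norm_num)]
  simp

/-- The one-sided Bernstein bound. -/
lemma integral_sub_integral_le_bernsteinBound {p p' : Kernel X X} [IsMarkovKernel p]
    [IsMarkovKernel p'] {μ' : Measure X} [IsProbabilityMeasure μ'] (hμ : p.Invariant μ)
    (hμ' : p'.Invariant μ') (hac : μ' ≪ μ) {α : ℝ} (hα : 0 < α)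
    (hP : PoincareInequality p μ hμ α) {f : X → ℝ} (hf : Measurable f) {C : ℝ}
    (hC : ∀ x, |f x| ≤ C) :
    ((∫ x, f x ∂μ' - ∫ x, f x ∂μ : ℝ) : EReal) ≤
      (bernsteinBound (ENNReal.ofReal (2 * α * Var[f; μ]))
        (ENNReal.ofReal α * eLpNorm (fun x => (f x - ∫ y, f y ∂μ)⁺) ∞ μ)
        (entropyRate p' p μ') : EReal) := by
  set c := ∫ y, f y ∂μ with hc
  set F : X → ℝ := fun x => f x - c with hFdef
  have hfint : ∀ ν : Measure X, [IsProbabilityMeasure ν] → Integrable f ν := fun ν _ =>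
    Integrable.of_bound hf.aestronglyMeasurable C (ae_of_all _ hC)
  have hF : Measurable F := hf.sub_const c
  have hFC : ∀ x, |F x| ≤ C + |c| := fun x =>
    (abs_sub _ _).trans (add_le_add_left (hC x) _)
  have hF0 : ∫ x, F x ∂μ = 0 := by
    rw [integral_sub (hfint μ) (integrable_const _)]; simp [hc]
  have hFμ' : ∫ x, F x ∂μ' = ∫ x, f x ∂μ' - c := by
    rw [integral_sub (hfint μ') (integrable_const _)]; simp
  have hVar : Var[f; μ] = ∫ x, F x ^ 2 ∂μ := variance_eq_integral hf.aemeasurable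
  rw [← hFμ']
  refine le_trans (b := ((ENNReal.ofReal (∫ x, F x ∂μ') : ℝ≥0∞) : EReal)) ?_
    (EReal.coe_ennreal_le_coe_ennreal_iff.2 ?_)
  · rw [EReal.coe_ennreal_ofReal]
    exact EReal.coe_le_coe_iff.2 (le_max_left _ _)
  have hV0 : 0 ≤ ∫ x, F x ^ 2 ∂μ := integral_nonneg fun x => sq_nonneg _
  rw [hVar]
  -- At `η = ∞` the bound is infinite unless `Var f = 0`; in that case `F = 0` holds `μ`-a.e., hence
  -- `μ'`-a.e., and the left side vanishes.
  by_cases hη : entropyRate p' p μ' = ∞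
  · rcases hV0.eq_or_lt with hV | hV
    · have hFsq : Integrable (fun x => F x ^ 2) μ :=
        (MemLp.of_bound hF.aestronglyMeasurable _ (ae_of_all _ hFC)).integrable_sq
      have h0 : ∀ᵐ x ∂μ', F x = 0 := by
        filter_upwards [hac.ae_le ((integral_eq_zero_iff_of_nonneg (fun x => sq_nonneg _) hFsq).1
          hV.symm)] with x hx
        exact pow_eq_zero_iff two_ne_zero |>.1 hx
      rw [integral_eq_zero_of_ae h0, ENNReal.ofReal_zero]
      exact zero_le
    · rw [hη, bernsteinBound_top]
      · exact le_top
      · exact (ENNReal.ofReal_pos.2 (by positivity)).ne'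
  set K := (eLpNorm (fun x => (F x)⁺) ∞ μ).toReal with hK
  have hKtop : eLpNorm (fun x => (F x)⁺) ∞ μ ≠ ∞ := by
    refine (MemLp.of_bound (p := ∞) (C := C + |c|) ?_ (ae_of_all _ fun x => ?_)).2.ne
    · exact (hF.sup_const 0).aestronglyMeasurable
    · rw [Real.norm_eq_abs, abs_of_nonneg (posPart_nonneg _), posPart_def]
      exact sup_le ((le_abs_self _).trans (hFC x)) ((abs_nonneg _).trans (hFC x))
  have hFK : ∀ᵐ x ∂μ, F x ≤ K := by
    filter_upwards [ae_le_eLpNormEssSup (f := fun x => (F x)⁺) (μ := μ)] with x hx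
    rw [← eLpNorm_exponent_top] at hx
    have h := ENNReal.toReal_mono hKtop hx
    rw [toReal_enorm, Real.norm_eq_abs, abs_of_nonneg (posPart_nonneg _)] at h
    exact (le_posPart _).trans h
  set g : X → ℝ := fun x => √(μ'.rnDeriv μ x).toReal with hgdef
  have hg : Measurable g := (Measure.measurable_rnDeriv μ' μ).ennreal_toReal.sqrt
  have hgsq : ∀ x, g x ^ 2 = (μ'.rnDeriv μ x).toReal := fun x =>
    Real.sq_sqrt ENNReal.toReal_nonneg
  have hg0 : ∀ x, 0 ≤ g x := fun x => Real.sqrt_nonneg _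
  have hg2 : MemLp g 2 μ := by
    rw [memLp_two_iff_integrable_sq hg.aestronglyMeasurable]
    simpa only [hgsq] using Measure.integrable_toReal_rnDeriv
  have hdens : ∀ φ : X → ℝ, ∫ x, φ x ∂μ' = ∫ x, g x ^ 2 * φ x ∂μ := fun φ => by
    simp only [hgsq]
    exact (integral_toReal_rnDeriv_mul hac).symm
  have hg1 : ∫ x, g x ^ 2 ∂μ = 1 := by simpa using (hdens fun _ => 1).symm
  have hdir := ofReal_one_sub_integral_mul_le_entropyRate (p := p) hμ' hg hg0 hg2
    (ae_integrable_kernel_of_memLp hμ hg2) ((memLp_kernel_average_real hμ hg2).integrable_mul hg2)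
    hdens
  set η := (entropyRate p' p μ').toReal with hηdef
  have hη0 : 0 ≤ η := ENNReal.toReal_nonneg
  set s := ∫ x, (g x - ∫ y, g y ∂μ) ^ 2 ∂μ with hs
  -- Poincaré for `g`, whose Dirichlet form is at most `η`.
  have hs_le : s ≤ α * η := by
    have h1 := hP.integral_le hg2
    rw [hg1] at h1
    have h2 := (ENNReal.ofReal_le_iff_le_toReal hη).1 hdir
    have h3 := h1.trans h2
    rwa [inv_mul_le_iff₀ hα] at h3
  have hK0 : 0 ≤ K := ENNReal.toReal_nonneg
  rw [← ENNReal.ofReal_toReal hη, ← ENNReal.ofReal_toReal hKtop, ← ENNReal.ofReal_mul hα.le,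
    bernsteinBound_ofReal (by positivity) (by positivity) hη0]
  refine ENNReal.ofReal_le_ofReal ?_
  rw [hdens]
  refine (integral_mul_sq_le hg2 hg0 hg1 hF hFC hF0 hFK).trans (add_le_add ?_ ?_)
  · have h4 : √(2 * (2 * α * ∫ x, F x ^ 2 ∂μ) * η) =
        2 * (√(∫ x, F x ^ 2 ∂μ) * √(α * η)) := by
      rw [← Real.sqrt_mul hV0, show 2 * (2 * α * ∫ x, F x ^ 2 ∂μ) * η =
        2 ^ 2 * ((∫ x, F x ^ 2 ∂μ) * (α * η)) by ring, Real.sqrt_mul (by norm_num),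
        Real.sqrt_sq (by norm_num)]
    rw [h4]
    gcongr
  · calc K * s ≤ K * (α * η) := by gcongr
      _ = α * K * η := by ring

end Bound

end DiscreteUQ

theorem mainTheorem11 {X : Type*} [TopologicalSpace X] [PolishSpace X] [MeasurableSpace X]
    [BorelSpace X]
    (p p' : Kernel X X) [IsMarkovKernel p] [IsMarkovKernel p']
    (μ μ' : Measure X) [IsProbabilityMeasure μ] [IsProbabilityMeasure μ']
    (hμ : p.Invariant μ) (hμ' : p'.Invariant μ')
    (hfin : klDiv μ' μ ≠ ∞)
    (α : ℝ) (hα : 0 < α) (hP : DiscreteUQ.PoincareInequality p μ hμ α)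
    (f : X → ℝ) (hf : Measurable f) (hbdd : ∃ C : ℝ, ∀ x, |f x| ≤ C) :
    (((∫ x, f x ∂μ' - ∫ x, f x ∂μ : ℝ) : EReal) ≤
      (DiscreteUQ.bernsteinBound
        (ENNReal.ofReal (2 * α * Var[f; μ]))
        (ENNReal.ofReal α * eLpNorm (fun x => (f x - ∫ y, f y ∂μ)⁺) ∞ μ)
        (DiscreteUQ.entropyRate p' p μ') : EReal)) ∧
    (((-(∫ x, f x ∂μ' - ∫ x, f x ∂μ) : ℝ) : EReal) ≤
      (DiscreteUQ.bernsteinBound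
        (ENNReal.ofReal (2 * α * Var[f; μ]))
        (ENNReal.ofReal α * eLpNorm (fun x => (f x - ∫ y, f y ∂μ)⁻) ∞ μ)
        (DiscreteUQ.entropyRate p' p μ') : EReal)) := by
  have hac : μ' ≪ μ := (klDiv_ne_top_iff.1 hfin).1
  obtain ⟨C, hC⟩ := hbdd
  refine ⟨DiscreteUQ.integral_sub_integral_le_bernsteinBound hμ hμ' hac hα hP hf hC, ?_⟩
  -- Passing to `-f` keeps the variance and turns the positive part into the negative part.
  have h := DiscreteUQ.integral_sub_integral_le_bernsteinBound hμ hμ' hac hα hP hf.neg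
    (C := C) fun x => by simpa using hC x
  have hpart : ∀ x, (-f x - -∫ y, f y ∂μ)⁺ = (f x - ∫ y, f y ∂μ)⁻ := fun x => by
    rw [← posPart_neg]
    congr 1
    ring
  simp only [Pi.neg_apply, integral_neg, variance_neg, hpart] at h
  rwa [neg_sub, ← neg_sub_neg]
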